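/- Let $p$ be an odd prime, let $G=C_{p^k}$ be a cyclic group of order $p^k$, and let $1\le j<i\le k$ be integers with $i+j\le k$. Let $\underline{B}_{i,j}$ be the $G$-Mackey functor with trivial Weyl action and values $$\underline{B}_{i,j}(G/C_{p^m})=\begin{cases}\mathbb Z/p^{i} & m\ge i+j,\\ \mathbb Z/p^{m-j} & j<m<i+j,\\ 0 & m\le j,\end{cases}$$ whose restriction maps are the canonical quotient maps and whose transfer maps $\underline{B}_{i,j}(G/C_{p^m})\to\underline{B}_{i,j}(G/C_{p^{m+1}})$ are multiplication by $p$. For a finite-dimensional real representation $W$ of $G$, a $G$-Mackey functor $\underline{M}$, an integer $n\ge 0$ and a subgroup $H\subseteq G$, let $$\underline{H}_{-n}(S^{-W};\underline{M})(G/H)=[G/H_+\wedge S^{-n},\,S^{-W}\wedge H\underline{M}]^G=[G/H_+\wedge S^{W},\,S^{n}\wedge H\underline{M}]^G=\widetilde H^{\,n}_H(S^W;\underline{M}),$$ the reduced Bredon cohomology in degree $n$ of the one-point compactification $S^W$ of $W$ as an $H$-space, with coefficients in the restriction of $\underline{M}$ to $H$. Let $H\subseteq G$ be a subgroup with $C_{p^{i+j}}\subseteq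 H$. Then for every finite-dimensional real representation $W$ of $G$ and for $\epsilon=0,1$ the restriction map $$\underline{H}_{-\epsilon}(S^{-W};\underline{B}_{i,j})(G/G)\longrightarrow \underline{H}_{-\epsilon}(S^{-W};\underline{B}_{i,j})(G/H)$$ is injective. -/

import Mathlib

open scoped OnePoint

noncomputable section

/-! ### Mackey functors for an abelian group -/

/-- A Mackey functor for an abelian group `G`: `obj K` is the value at `G/K`, with restrictions,
transfers and the action of `G` (through the Weyl group `G/K`), subject to functoriality,
equivariance and the double coset formula. -/
structure MackeyFunctor.{v, u} (G : Type u) [CommGroup G] where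
  obj : Subgroup G → Type v
  [instAddCommGroup : ∀ K, AddCommGroup (obj K)]
  res : ∀ {K L : Subgroup G}, K ≤ L → obj L →+ obj K
  tr : ∀ {K L : Subgroup G}, K ≤ L → obj K →+ obj L
  weyl : ∀ K : Subgroup G, G → obj K →+ obj K
  weyl_one : ∀ K x, weyl K 1 x = x
  weyl_mul : ∀ K g h x, weyl K (g * h) x = weyl K g (weyl K h x)
  weyl_mem : ∀ K, ∀ g ∈ K, ∀ x, weyl K g x = x
  res_refl : ∀ (K : Subgroup G) x, res (le_refl K) x = x
  tr_refl : ∀ (K : Subgroup G) x, tr (le_refl K) x = x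
  res_res : ∀ {K L J : Subgroup G} (hKL : K ≤ L) (hLJ : L ≤ J) x,
    res hKL (res hLJ x) = res (hKL.trans hLJ) x
  tr_tr : ∀ {K L J : Subgroup G} (hKL : K ≤ L) (hLJ : L ≤ J) x,
    tr hLJ (tr hKL x) = tr (hKL.trans hLJ) x
  res_weyl : ∀ {K L : Subgroup G} (hKL : K ≤ L) g x, res hKL (weyl L g x) = weyl K g (res hKL x)
  tr_weyl : ∀ {K L : Subgroup G} (hKL : K ≤ L) g x, tr hKL (weyl K g x) = weyl L g (tr hKL x)
  res_tr : ∀ {K L J : Subgroup G} (hKJ : K ≤ J) (hLJ : L ≤ J) x,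
    res hKJ (tr hLJ x) = ∑ᶠ c : J ⧸ (K ⊔ L).subgroupOf J,
      tr (inf_le_left : K ⊓ L ≤ K) (weyl (K ⊓ L) (c.out : G) (res (inf_le_right : K ⊓ L ≤ L) x))

attribute [instance] MackeyFunctor.instAddCommGroup

/-! ### The Mackey functors `B_{i,j}` -/

section MackeyB

variable {G : Type*} [CommGroup G] (p i j : ℕ)

/-- The value of `B_{i,j}` at a subgroup of order `p ^ m` is `ℤ/p^e` with `e = min i (m - j)`
(truncated subtraction), i.e. `e = i` if `i + j ≤ m`, `e = m - j` if `j < m < i + j`, and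
`e = 0` if `m ≤ j`. -/
def mackeyBExp (K : Subgroup G) : ℕ := min i (padicValNat p (Nat.card K) - j)

variable [Finite G] [hp : Fact p.Prime]

lemma padicValNat_card_eq {K L : Subgroup G} (h : K ≤ L) :
    padicValNat p (Nat.card L) = padicValNat p (Nat.card K) + padicValNat p (K.relIndex L) := by
  have hn : K.relIndex L ≠ 0 := Subgroup.FiniteIndex.index_ne_zero
  rw [← padicValNat.mul Nat.card_pos.ne' hn, ← Subgroup.relIndex_bot_left K,
    Subgroup.relIndex_mul_relIndex _ _ _ bot_le h, Subgroup.relIndex_bot_left]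

lemma mackeyBExp_mono {K L : Subgroup G} (h : K ≤ L) : mackeyBExp p i j K ≤ mackeyBExp p i j L := by
  have := padicValNat_card_eq p h
  unfold mackeyBExp
  omega

lemma pow_mackeyBExp_dvd {K L : Subgroup G} (h : K ≤ L) :
    p ^ mackeyBExp p i j L ∣ K.relIndex L * p ^ mackeyBExp p i j K := by
  have h1 := padicValNat_card_eq p h
  have h2 : p ^ padicValNat p (K.relIndex L) ∣ K.relIndex L := pow_padicValNat_dvd
  refine dvd_trans ?_ (mul_dvd_mul_right h2 _)
  rw [← pow_add]
  refine pow_dvd_pow _ ?_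
  unfold mackeyBExp
  omega

/-- The restriction maps of `B_{i,j}`: the canonical quotient maps. -/
def mackeyBRes {K L : Subgroup G} (h : K ≤ L) :
    ZMod (p ^ mackeyBExp p i j L) →+ ZMod (p ^ mackeyBExp p i j K) :=
  (ZMod.castHom (pow_dvd_pow p (mackeyBExp_mono p i j h)) _).toAddMonoidHom

/-- The transfer maps of `B_{i,j}`: multiplication by the index, `[a] ↦ [[L : K] a]`. In
particular it is multiplication by `p` if `K` has index `p` in `L`. -/
def mackeyBTr {K L : Subgroup G} (h : K ≤ L) :
    ZMod (p ^ mackeyBExp p i j K) →+ ZMod (p ^ mackeyBExp p i j L) :=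
  ZMod.lift _ ⟨K.relIndex L • Int.castAddHom (ZMod (p ^ mackeyBExp p i j L)), by
    have := (ZMod.natCast_eq_zero_iff _ _).2 (pow_mackeyBExp_dvd p i j h)
    simpa using this⟩

@[simp] lemma mackeyBRes_intCast {K L : Subgroup G} (h : K ≤ L) (a : ℤ) :
    mackeyBRes p i j h (a : ZMod _) = (a : ZMod _) := by
  simp [mackeyBRes]

@[simp] lemma mackeyBTr_intCast {K L : Subgroup G} (h : K ≤ L) (a : ℤ) :
    mackeyBTr p i j h (a : ZMod _) = ((K.relIndex L * a : ℤ) : ZMod _) := by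
  simp [mackeyBTr]

/-- The Mackey functor `B_{i,j}`, with trivial Weyl action. -/
def mackeyB (G : Type*) [CommGroup G] [Finite G] (p i j : ℕ) [Fact p.Prime] :
    MackeyFunctor.{0} G where
  obj K := ZMod (p ^ mackeyBExp p i j K)
  res h := mackeyBRes p i j h
  tr h := mackeyBTr p i j h
  weyl _ _ := AddMonoidHom.id _
  weyl_one _ _ := rfl
  weyl_mul _ _ _ _ := rfl
  weyl_mem _ _ _ _ := rfl
  res_refl K x := by obtain ⟨a, rfl⟩ := ZMod.intCast_surjective x; simp
  tr_refl K x := by obtain ⟨a, rfl⟩ := ZMod.intCast_surjective x; simp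
  res_res _ _ x := by obtain ⟨a, rfl⟩ := ZMod.intCast_surjective x; simp
  tr_tr {K L J} hKL hLJ x := by
    obtain ⟨a, rfl⟩ := ZMod.intCast_surjective x
    rw [mackeyBTr_intCast, mackeyBTr_intCast, mackeyBTr_intCast,
      ← Subgroup.relIndex_mul_relIndex K L J hKL hLJ]
    push_cast
    ring
  res_weyl _ _ _ := rfl
  tr_weyl _ _ _ := rfl
  res_tr {K L J} hKJ hLJ x := by
    obtain ⟨a, rfl⟩ := ZMod.intCast_surjective x
    have := Fintype.ofFinite (J ⧸ (K ⊔ L).subgroupOf J)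
    have hc : Fintype.card (J ⧸ (K ⊔ L).subgroupOf J) = (K ⊔ L).relIndex J := by
      rw [← Nat.card_eq_fintype_card]; rfl
    have hr : L.relIndex J = (K ⊔ L).relIndex J * (K ⊓ L).relIndex K := by
      rw [← Subgroup.relIndex_mul_relIndex L (K ⊔ L) J le_sup_right (sup_le hKJ hLJ),
        Subgroup.relIndex_sup_right, Subgroup.inf_relIndex_left, mul_comm]
    rw [finsum_eq_sum_of_fintype]
    simp only [mackeyBTr_intCast, mackeyBRes_intCast, AddMonoidHom.id_apply, Finset.sum_const,
      Finset.card_univ, hc, hr]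
    push_cast
    rw [nsmul_eq_mul]
    ring

end MackeyB

/-! ### Reduced Bredon cohomology by equivariant singular cochains -/

section Bredon

variable {G : Type*} [CommGroup G]
variable (X : Type*) [TopologicalSpace X] [MulAction G X]

/-- The singular `n`-simplices of the fixed point space `X^K`. -/
abbrev FixedSimplex (n : ℕ) (K : Subgroup G) : Type _ :=
  {σ : C(stdSimplex ℝ (Fin (n + 1)), X) // ∀ k ∈ K, ∀ t, k • σ t = σ t}

namespace FixedSimplex

variable {X} {n : ℕ} {K L : Subgroup G}

/-- The `i`-th face. -/
def face (σ : FixedSimplex X (n + 1) K) (i : Fin (n + 2)) : FixedSimplex X n K :=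
  ⟨⟨fun t => σ.1 (stdSimplex.map i.succAbove t),
    σ.1.continuous.comp (stdSimplex.continuous_map _)⟩, fun k hk _ => σ.2 k hk _⟩

/-- The inclusion `X^L ⊆ X^K` for `K ≤ L`. -/
def incl (h : K ≤ L) (σ : FixedSimplex X n L) : FixedSimplex X n K :=
  ⟨σ.1, fun k hk => σ.2 k (h hk)⟩

/-- The action of `G` on the singular simplices of `X^K`. -/
def translate [ContinuousConstSMul G X] (g : G) (σ : FixedSimplex X n K) : FixedSimplex X n K :=
  ⟨⟨fun t => g • σ.1 t, σ.1.continuous.const_smul g⟩, fun k hk t => by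
    change k • g • σ.1 t = g • σ.1 t
    rw [smul_comm, σ.2 k hk t]⟩

lemma face_face (σ : FixedSimplex X (n + 2) K) {i j : Fin (n + 2)} (h : i ≤ j) :
    (σ.face j.succ).face i = (σ.face i.castSucc).face j := by
  have key : (j.succ.succAbove ∘ i.succAbove : Fin (n + 1) → Fin (n + 3)) =
      i.castSucc.succAbove ∘ j.succAbove := by
    funext k
    rw [Fin.le_def] at h
    ext
    simp only [Function.comp, Fin.succAbove, Fin.lt_def]
    split_ifs <;> simp_all <;> omega
  apply Subtype.ext
  ext t
  simp only [face, ContinuousMap.coe_mk, stdSimplex.map_comp_apply]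
  exact congrArg (fun f => σ.1 (stdSimplex.map f t)) key

end FixedSimplex

variable [ContinuousConstSMul G X] (x₀ : X) (M : MackeyFunctor G)

/-- The group of reduced Bredon `n`-cochains of the `H`-space `X`, with base point `x₀` and
coefficients in the restriction of `M` to `H`: families of functions
`f K : Sing_n (X^K) → M(G/K)`, for `K ≤ H`, natural in the orbit category of `H` (that is,
compatible with restriction and with the action of `H`) which vanish at the base point. -/
def bredonCochain (n : ℕ) (H : Subgroup G) :
    AddSubgroup (∀ K : Set.Iic H, FixedSimplex X n K.1 → M.obj K.1) where
  carrier := {f |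
    (∀ (K L : Set.Iic H) (h : K.1 ≤ L.1) (σ : FixedSimplex X n L.1),
      f K (σ.incl h) = M.res h (f L σ)) ∧
    (∀ (K : Set.Iic H), ∀ g ∈ H, ∀ σ : FixedSimplex X n K.1,
      f K (σ.translate g) = M.weyl K.1 g (f K σ)) ∧
    (∀ (K : Set.Iic H) (σ : FixedSimplex X n K.1), (∀ t, σ.1 t = x₀) → f K σ = 0)}
  zero_mem' := by simp
  add_mem' := by
    rintro f f' ⟨h1, h2, h3⟩ ⟨h1', h2', h3'⟩
    refine ⟨fun K L h σ => ?_, fun K g hg σ => ?_, fun K σ hσ => ?_⟩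
    · simp only [Pi.add_apply, map_add, h1 K L h, h1' K L h]
    · simp only [Pi.add_apply, map_add, h2 K g hg, h2' K g hg]
    · simp only [Pi.add_apply, h3 K σ hσ, h3' K σ hσ, add_zero]
  neg_mem' := by
    rintro f ⟨h1, h2, h3⟩
    refine ⟨fun K L h σ => ?_, fun K g hg σ => ?_, fun K σ hσ => ?_⟩
    · simp only [Pi.neg_apply, map_neg, h1 K L h]
    · simp only [Pi.neg_apply, map_neg, h2 K g hg]
    · simp only [Pi.neg_apply, h3 K σ hσ, neg_zero]

/-- The coboundary `(δ f)(σ) = ∑ᵢ (-1)ⁱ f(∂ᵢ σ)`. -/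
def bredonCoboundary (n : ℕ) (H : Subgroup G) :
    bredonCochain X x₀ M n H →+ bredonCochain X x₀ M (n + 1) H where
  toFun f := ⟨fun K σ => ∑ i : Fin (n + 2), (-1 : ℤ) ^ (i : ℕ) • f.1 K (σ.face i), by
    obtain ⟨f, h1, h2, h3⟩ := f
    refine ⟨fun K L h σ => ?_, fun K g hg σ => ?_, fun K σ hσ => ?_⟩
    · simp only [map_sum, map_zsmul, ← h1 K L h]
      rfl
    · simp only [map_sum, map_zsmul, ← h2 K g hg]
      rfl
    · refine Finset.sum_eq_zero fun i _ => ?_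
      exact (congrArg _ (h3 K (σ.face i) fun t => hσ _)).trans (smul_zero _)⟩
  map_zero' := by
    apply Subtype.ext
    funext K σ
    simp
  map_add' f f' := by
    apply Subtype.ext
    funext K σ
    simp [Finset.sum_add_distrib]

lemma bredonCoboundary_bredonCoboundary (n : ℕ) (H : Subgroup G)
    (f : bredonCochain X x₀ M n H) :
    bredonCoboundary X x₀ M (n + 1) H (bredonCoboundary X x₀ M n H f) = 0 := by
  apply Subtype.ext
  funext K σ
  change ∑ a : Fin (n + 3), (-1 : ℤ) ^ (a : ℕ) • ∑ b : Fin (n + 2), (-1 : ℤ) ^ (b : ℕ) •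
    f.1 K ((σ.face a).face b) = 0
  simp only [Finset.smul_sum, smul_smul, ← pow_add]
  rw [Finset.sum_comm, ← Finset.sum_product']
  let S : Finset (Fin (n + 2) × Fin (n + 3)) := {q | (q.2 : ℕ) ≤ (q.1 : ℕ)}
  rw [Finset.univ_product_univ, ← Finset.sum_add_sum_compl S, ← eq_neg_iff_add_eq_zero,
    ← Finset.sum_neg_distrib]
  refine Finset.sum_bij (fun q hq => (Fin.castLT q.2
    (lt_of_le_of_lt (Finset.mem_filter.mp hq).right q.1.isLt), q.1.succ)) ?_ ?_ ?_ ?_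
  · intro q hq
    simp only [S, Finset.compl_filter, Finset.mem_filter_univ, Fin.val_succ,
      Fin.val_castLT] at hq ⊢
    omega
  · rintro ⟨a, b⟩ hq ⟨a', b'⟩ hq' h
    simp only [Prod.mk.injEq, Fin.ext_iff, Fin.val_castLT, Fin.val_succ] at h ⊢
    omega
  · rintro ⟨a, b⟩ hq
    simp only [S, Finset.compl_filter, Finset.mem_filter_univ, not_le] at hq
    refine ⟨(b.pred fun h => by simp [h] at hq, a.castSucc), ?_, ?_⟩
    · simp only [S, Finset.mem_filter_univ, Fin.val_castSucc, Fin.val_pred]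
      omega
    · simp
  · rintro ⟨a, b⟩ hq
    simp only [S, Finset.mem_filter_univ] at hq
    have hb : (b : ℕ) < n + 2 := lt_of_le_of_lt hq a.isLt
    have hf := σ.face_face (i := b.castLT hb) (j := a) (by simpa [Fin.le_def] using hq)
    simp only [Fin.castSucc_castLT] at hf
    rw [hf, ← neg_smul]
    congr 1
    simp only [Fin.val_succ, Fin.val_castLT]
    ring

/-- Reduced Bredon `n`-cocycles. -/
def bredonCocycle (n : ℕ) (H : Subgroup G) : AddSubgroup (bredonCochain X x₀ M n H) :=
  (bredonCoboundary X x₀ M n H).ker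

/-- The image of the coboundary in degree `n`; it is zero for `n = 0`. -/
def bredonBoundary (H : Subgroup G) : ∀ n : ℕ, AddSubgroup (bredonCochain X x₀ M n H)
  | 0 => ⊥
  | n + 1 => (bredonCoboundary X x₀ M n H).range

/-- The reduced Bredon cohomology group of the `H`-space `X` with coefficients in (the
restriction to `H` of) the Mackey functor `M`. -/
abbrev BredonCohomology (n : ℕ) (H : Subgroup G) : Type _ :=
  bredonCocycle X x₀ M n H ⧸
    (bredonBoundary X x₀ M H n).addSubgroupOf (bredonCocycle X x₀ M n H)

variable {H H' : Subgroup G} (hH : H ≤ H')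

/-- Restriction of cochains from `H'` to `H`. -/
def bredonCochainRes (n : ℕ) : bredonCochain X x₀ M n H' →+ bredonCochain X x₀ M n H where
  toFun f := ⟨fun K => f.1 ⟨K.1, K.2.trans hH⟩,
    fun K L => f.2.1 ⟨K.1, K.2.trans hH⟩ ⟨L.1, L.2.trans hH⟩,
    fun K g hg => f.2.2.1 ⟨K.1, K.2.trans hH⟩ g (hH hg),
    fun K => f.2.2.2 ⟨K.1, K.2.trans hH⟩⟩
  map_zero' := rfl
  map_add' _ _ := rfl

lemma bredonCoboundary_res (n : ℕ) (f : bredonCochain X x₀ M n H') :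
    bredonCoboundary X x₀ M n H (bredonCochainRes X x₀ M hH n f) =
      bredonCochainRes X x₀ M hH (n + 1) (bredonCoboundary X x₀ M n H' f) := rfl

/-- Restriction of cocycles from `H'` to `H`. -/
def bredonCocycleRes (n : ℕ) : bredonCocycle X x₀ M n H' →+ bredonCocycle X x₀ M n H :=
  ((bredonCochainRes X x₀ M hH n).comp (bredonCocycle X x₀ M n H').subtype).codRestrict _ (by
    rintro ⟨f, hf⟩
    change bredonCoboundary X x₀ M n H (bredonCochainRes X x₀ M hH n f) = 0
    rw [bredonCoboundary_res, show bredonCoboundary X x₀ M n H' f = 0 from hf, map_zero])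

/-- The restriction map from `H'` to `H` in reduced Bredon cohomology. -/
def bredonRes (n : ℕ) : BredonCohomology X x₀ M n H' →+ BredonCohomology X x₀ M n H :=
  QuotientAddGroup.map _ _ (bredonCocycleRes X x₀ M hH n) (by
    rintro ⟨f, hf⟩ hb
    change f ∈ bredonBoundary X x₀ M H' n at hb
    change bredonCochainRes X x₀ M hH n f ∈ bredonBoundary X x₀ M H n
    cases n with
    | zero =>
      rw [show f = 0 from hb, map_zero]
      exact zero_mem _
    | succ n =>
      obtain ⟨e, rfl⟩ := hb
      exact ⟨bredonCochainRes X x₀ M hH n e, rfl⟩)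

end Bredon

/-! ### Representation spheres -/

section RepSphere

variable {G : Type*} [CommGroup G] {V : Type*} [NormedAddCommGroup V] [NormedSpace ℝ V]

/-- The representation sphere `S^V`, the one-point compactification of `V`. -/
def RepSphere (_W : Representation ℝ G V) : Type _ := OnePoint V

variable (W : Representation ℝ G V)

instance : TopologicalSpace (RepSphere W) := inferInstanceAs (TopologicalSpace (OnePoint V))

/-- The base point `∞` of `S^V`. -/
def RepSphere.infty : RepSphere W := (∞ : OnePoint V)

/-- `G` acts on `S^V` through the representation, fixing `∞`. -/
instance : MulAction G (RepSphere W) where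
  smul g x := OnePoint.map (W g) x
  one_smul x := by
    change OnePoint.map (W 1) x = x
    rw [map_one]
    exact congrFun OnePoint.map_id x
  mul_smul g h x := by
    change OnePoint.map (W (g * h)) x = OnePoint.map (W g) (OnePoint.map (W h) x)
    rw [map_mul]
    exact congrFun (OnePoint.map_comp (W g) (W h)) x

instance [FiniteDimensional ℝ V] : ContinuousConstSMul G (RepSphere W) where
  continuous_const_smul g := by
    let e : V ≃L[ℝ] V := LinearEquiv.toContinuousLinearEquiv
      (LinearEquiv.ofLinearMap (W g) (W g⁻¹)
        (by rw [← Module.End.mul_eq_comp, ← map_mul, mul_inv_cancel, map_one]; rfl)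
        (by rw [← Module.End.mul_eq_comp, ← map_mul, inv_mul_cancel, map_one]; rfl))
    refine OnePoint.continuous_map (f := W g) e.continuous ?_
    rw [Filter.coclosedCompact_eq_cocompact]
    exact e.toHomeomorph.isClosedEmbedding.tendsto_cocompact

variable [FiniteDimensional ℝ V]

/-- The homology group `H_{-n}(S^{-W}; M)(G/H) = [G/H₊ ∧ S^{-n}, S^{-W} ∧ HM]^G`, in
nonpositive degree `-n`. By invertibility of `S^W` it is `[G/H₊ ∧ S^W, S^n ∧ HM]^G`, the reduced
Bredon cohomology in degree `n` of the `H`-space `S^W` with coefficients in `M`. -/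
abbrev NegSphereHomology (M : MackeyFunctor G) (n : ℕ) (H : Subgroup G) : Type _ :=
  BredonCohomology (RepSphere W) (RepSphere.infty W) M n H

/-- The restriction map `H_{-n}(S^{-W}; M)(G/H') → H_{-n}(S^{-W}; M)(G/H)`. -/
def negSphereHomologyRes (M : MackeyFunctor G) (n : ℕ) {H H' : Subgroup G} (h : H ≤ H') :
    NegSphereHomology W M n H' →+ NegSphereHomology W M n H :=
  bredonRes (RepSphere W) (RepSphere.infty W) M h n

end RepSphere

end

/-! ### Subgroups of cyclic groups -/

/-! Write M for B_{i,j} and C for the subgroup of order p^(i+j). Every restriction M(G/K) → M(G/(K ∩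
H)) is an isomorphism (`mackeyB_res_inf_bijective`): subgroups of G form a chain, so either K ≤ C ≤
H, or both K and K ∩ H contain C and have value ℤ/p^i. Hence a cochain on G is determined by its
restriction to H, which settles degree 0, where there are no coboundaries. Moreover, a cochain on H
extends to G once it is equivariant for G and not only for H (`exists_bredonCochainRes_eq`).

In degree 1, let f be a cocycle on G whose restriction to H is δe. The points 0 and ∞ of S^W are
fixed by G. Any other point of (S^W)^K is joined to ∞ by a ray inside (S^W)^K; since e vanishes at
∞, its value at the point is the value of f on the ray. As f is G-equivariant and the Weyl action is
trivial, e is G-invariant (`bredonCochain_translate_of_coboundary_eq`). So e extends to G, and the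
coboundary of the extension is f because both agree on H. -/

/-- In a cyclic group x ^ n = 1 has at most n solutions, so for n = |L| the solutions are exactly
the elements of L; those of K are among them. -/
lemma Subgroup.le_of_card_dvd_card {G : Type*} [Group G] [Finite G] [IsCyclic G]
    {K L : Subgroup G} (h : Nat.card K ∣ Nat.card L) : K ≤ L := by
  classical
  have := Fintype.ofFinite G
  have hpow : ∀ {N : Subgroup G} {x : G}, x ∈ N → x ^ Nat.card N = 1 := fun {N} x hx => by
    exact congrArg Subtype.val (pow_card_eq_one' (x := (⟨x, hx⟩ : N)))
  let S : Finset G := Finset.univ.filter fun x => x ^ Nat.card L = 1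
  have hsub : (L : Set G).toFinset ⊆ S := fun x hx =>
    Finset.mem_filter.2 ⟨Finset.mem_univ _, hpow (Set.mem_toFinset.1 hx)⟩
  have hcard : S.card ≤ (L : Set G).toFinset.card := by
    refine (IsCyclic.card_pow_eq_one_le Nat.card_pos).trans_eq ?_
    rw [Set.toFinset_card, ← Nat.card_eq_fintype_card]
    rfl
  intro x hx
  have hxS : x ∈ S := by
    obtain ⟨c, hc⟩ := h
    exact Finset.mem_filter.2 ⟨Finset.mem_univ _, by rw [hc, pow_mul, hpow hx, one_pow]⟩
  rw [← Finset.eq_of_subset_of_card_le hsub hcard] at hxS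
  exact Set.mem_toFinset.1 hxS

lemma Subgroup.le_or_le_of_card_eq_prime_pow {G : Type*} [Group G] [Finite G] [IsCyclic G]
    {p k : ℕ} (hp : p.Prime) (hG : Nat.card G = p ^ k) (K L : Subgroup G) : K ≤ L ∨ L ≤ K := by
  obtain ⟨a, -, ha⟩ := (Nat.dvd_prime_pow hp).1 (hG ▸ K.card_subgroup_dvd_card)
  obtain ⟨b, -, hb⟩ := (Nat.dvd_prime_pow hp).1 (hG ▸ L.card_subgroup_dvd_card)
  rcases le_total a b with h | h
  · exact .inl (Subgroup.le_of_card_dvd_card (ha ▸ hb ▸ pow_dvd_pow p h))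
  · exact .inr (Subgroup.le_of_card_dvd_card (ha ▸ hb ▸ pow_dvd_pow p h))

/-! ### Restriction maps of `B_{i,j}` between large subgroups -/

lemma mackeyBRes_bijective {G : Type*} [CommGroup G] [Finite G] (p i j : ℕ) [Fact p.Prime]
    {K L : Subgroup G} (h : K ≤ L) (he : mackeyBExp p i j L = mackeyBExp p i j K) :
    Function.Bijective (mackeyBRes p i j h) := by
  refine ⟨(injective_iff_map_eq_zero _).2 fun x hx => ?_, fun y => ?_⟩
  · obtain ⟨a, rfl⟩ := ZMod.intCast_surjective x
    rw [mackeyBRes_intCast, ZMod.intCast_zmod_eq_zero_iff_dvd] at hx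
    rwa [ZMod.intCast_zmod_eq_zero_iff_dvd, he]
  · obtain ⟨a, rfl⟩ := ZMod.intCast_surjective y
    exact ⟨a, mackeyBRes_intCast p i j h a⟩

lemma mackeyB_res_inf_bijective {G : Type*} [CommGroup G] [Finite G] [IsCyclic G]
    (p k i j : ℕ) [hp : Fact p.Prime] (hG : Nat.card G = p ^ k) {C H : Subgroup G}
    (hC : Nat.card C = p ^ (i + j)) (hCH : C ≤ H) (K : Subgroup G) :
    Function.Bijective ((mackeyB G p i j).res (inf_le_left : K ⊓ H ≤ K)) := by
  refine mackeyBRes_bijective p i j inf_le_left ?_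
  rcases Subgroup.le_or_le_of_card_eq_prime_pow hp.out hG K C with h | h
  · rw [inf_eq_left.2 (h.trans hCH)]
  · have hexp : ∀ L : Subgroup G, C ≤ L → mackeyBExp p i j L = i := fun L hL => by
      have := padicValNat_card_eq p hL
      rw [hC, padicValNat.prime_pow] at this
      unfold mackeyBExp
      omega
    rw [hexp K h, hexp _ (le_inf h hCH)]

/-! ### Extending cochains along isomorphic restrictions -/

section Extend

variable {G : Type*} [CommGroup G] {X : Type*} [TopologicalSpace X] [MulAction G X]
  [ContinuousConstSMul G X] {x₀ : X} {M : MackeyFunctor G} {H : Subgroup G}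

/-- A simplex of X^K is also one of X^(K ∩ H), and the value of f there is the restriction of its
value at K. -/
lemma bredonCochainRes_injective
    (hM : ∀ K, Function.Injective (M.res (inf_le_left : K ⊓ H ≤ K))) (n : ℕ) :
    Function.Injective (bredonCochainRes X x₀ M (le_top : H ≤ ⊤) n) := by
  refine (injective_iff_map_eq_zero _).2 fun f hf => ?_
  apply Subtype.ext
  funext K σ
  apply hM K.1
  rw [← f.2.1 ⟨K.1 ⊓ H, Set.mem_Iic.2 le_top⟩ K inf_le_left σ]
  exact (congrFun (congrFun (congrArg Subtype.val hf) ⟨K.1 ⊓ H, Set.mem_Iic.2 inf_le_right⟩) _).trans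
    (map_zero _).symm

/-- A cochain on `H` that is equivariant for the whole group extends to the whole group if the
restriction maps `M(G/K) → M(G/(K ⊓ H))` are isomorphisms. -/
lemma exists_bredonCochainRes_eq
    (hM : ∀ K, Function.Bijective (M.res (inf_le_left : K ⊓ H ≤ K))) {n : ℕ}
    (e : bredonCochain X x₀ M n H)
    (he : ∀ (K : Set.Iic H) (g : G) (σ : FixedSimplex X n K.1),
      e.1 K (σ.translate g) = M.weyl K.1 g (e.1 K σ)) :
    ∃ e' : bredonCochain X x₀ M n (⊤ : Subgroup G),
      bredonCochainRes X x₀ M le_top n e' = e := by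
  -- This value is forced by naturality. The cochain conditions are then checked after the injective
  -- restriction to K ∩ H, where they hold for e.
  choose E hE using fun (K : Subgroup G) (σ : FixedSimplex X n K) =>
    (hM K).2 (e.1 ⟨K ⊓ H, Set.mem_Iic.2 inf_le_right⟩ (σ.incl inf_le_left))
  refine ⟨⟨fun K => E K.1, fun K L h σ => (hM K.1).1 ?_, fun K g _ σ => (hM K.1).1 ?_,
    fun K σ hσ => (hM K.1).1 ?_⟩, ?_⟩
  · rw [hE, M.res_res, ← M.res_res (inf_le_inf_right H h) inf_le_left, hE,
      ← e.2.1 ⟨K.1 ⊓ H, Set.mem_Iic.2 inf_le_right⟩ ⟨L.1 ⊓ H, Set.mem_Iic.2 inf_le_right⟩]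
    rfl
  · rw [hE, M.res_weyl, hE]
    -- Here g need not lie in H, so the equivariance built into e does not suffice.
    exact he ⟨K.1 ⊓ H, Set.mem_Iic.2 inf_le_right⟩ g (σ.incl inf_le_left)
  · rw [hE, map_zero]
    exact e.2.2.2 _ _ hσ
  · apply Subtype.ext
    funext K σ
    apply (hM K.1).1
    refine (hE K.1 σ).trans ?_
    exact e.2.1 ⟨K.1 ⊓ H, Set.mem_Iic.2 inf_le_right⟩ K inf_le_left σ

end Extend

/-! ### Paths to the base point of a representation sphere -/

section RepSphere

variable {G : Type*} [CommGroup G] {V : Type*} [NormedAddCommGroup V] [NormedSpace ℝ V]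
  (W : Representation ℝ G V)

open Filter Topology in
-- For s from 0 to 1 this is the ray from ∞ to w; continuity at 0 holds because the norm of s⁻¹ • w
-- tends to infinity.
lemma continuous_onePoint_inv_smul [FiniteDimensional ℝ V] {w : V} (hw : w ≠ 0) :
    Continuous fun s : ℝ => if s = 0 then (∞ : OnePoint V) else ((s⁻¹ • w : V) : OnePoint V) := by
  have := FiniteDimensional.proper_real V
  rw [continuous_iff_continuousAt]
  intro s
  by_cases hs : s = 0
  · subst hs
    rw [continuousAt_iff_punctured_nhds, if_pos rfl]
    have h1 : Tendsto (fun s : ℝ => s⁻¹ • w) (𝓝[≠] 0) (coclosedCompact V) := by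
      rw [coclosedCompact_eq_cocompact, ← Metric.cobounded_eq_cocompact,
        ← tendsto_norm_atTop_iff_cobounded]
      simp only [norm_smul]
      exact (tendsto_norm_inv_nhdsNE_zero_atTop (α := ℝ)).atTop_mul_const (norm_pos_iff.2 hw)
    refine (OnePoint.tendsto_coe_infty.comp h1).congr' ?_
    filter_upwards [self_mem_nhdsWithin] with s hs
    exact (if_neg hs).symm
  · have h1 : ContinuousAt (fun s : ℝ => ((s⁻¹ • w : V) : OnePoint V)) s :=
      OnePoint.continuous_coe.continuousAt.comp
        ((continuousAt_inv₀ hs).smul continuousAt_const)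
    refine h1.congr ?_
    filter_upwards [isOpen_ne.mem_nhds hs] with s hs
    exact (if_neg hs).symm

lemma RepSphere.smul_infty (g : G) : g • RepSphere.infty W = RepSphere.infty W := rfl

/-- The inclusion `V ⊆ S^V`. -/
def RepSphere.ofVec (w : V) : RepSphere W := (w : OnePoint V)

lemma RepSphere.smul_ofVec (g : G) (w : V) :
    g • RepSphere.ofVec W w = RepSphere.ofVec W (W g w) := rfl

variable [FiniteDimensional ℝ V]

/-- A point of `(S^V)^K` is fixed by the whole group or joined to the base point in `(S^V)^K`. -/
lemma RepSphere.translate_eq_or_exists_path {K : Subgroup G}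
    (σ : FixedSimplex (RepSphere W) 0 K) :
    (∀ g : G, σ.translate g = σ) ∨
      ∃ τ : FixedSimplex (RepSphere W) 1 K,
        τ.face 0 = σ ∧ ∀ t, (τ.face 1).1 t = RepSphere.infty W := by
  have hconst : ∀ t, σ.1 t = σ.1 default := fun t => congrArg σ.1 (Subsingleton.elim _ _)
  rcases h : (σ.1 default : OnePoint V) with _ | w
  · refine .inl fun g => Subtype.ext (ContinuousMap.ext fun t => ?_)
    change g • σ.1 t = σ.1 t
    rw [hconst]
    refine (congrArg (g • ·) h).trans (Eq.trans ?_ h.symm)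
    exact RepSphere.smul_infty W g
  replace h : σ.1 default = RepSphere.ofVec W w := h
  -- The origin has no ray to ∞ (if V^K = 0 it is not joined to ∞ in the fixed points), but it is
  -- fixed by G.
  by_cases hw : w = 0
  · refine .inl fun g => Subtype.ext (ContinuousMap.ext fun t => ?_)
    change g • σ.1 t = σ.1 t
    rw [hconst, h, RepSphere.smul_ofVec, hw, map_zero]
  · have hfix : ∀ g ∈ K, W g w = w := fun g hg => by
      have := σ.2 g hg default
      rw [h, RepSphere.smul_ofVec] at this
      exact OnePoint.coe_injective this
    let c : ℝ → RepSphere W :=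
      fun s => if s = 0 then RepSphere.infty W else RepSphere.ofVec W (s⁻¹ • w)
    have hc0 : c 0 = RepSphere.infty W := if_pos rfl
    have hc1 : c 1 = RepSphere.ofVec W w := by simp [c]
    have hc : Continuous c := continuous_onePoint_inv_smul hw
    have hcfix : ∀ g ∈ K, ∀ s, g • c s = c s := fun g hg s => by
      by_cases hs : s = 0
      · rw [hs, hc0, RepSphere.smul_infty]
      · rw [show c s = RepSphere.ofVec W (s⁻¹ • w) from if_neg hs, RepSphere.smul_ofVec, map_smul,
          hfix g hg]
    -- The parameter is the barycentric coordinate of vertex 1. Face 0 omits vertex 0, giving c 1 =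
    -- w; face 1 gives c 0 = ∞.
    refine .inr ⟨⟨⟨fun t => c (t.1 1), hc.comp ((continuous_apply 1).comp continuous_subtype_val)⟩,
      fun g hg t => hcfix g hg _⟩, ?_, fun t => ?_⟩
    · refine Subtype.ext (ContinuousMap.ext fun t => ?_)
      rw [hconst, h, ← hc1]
      change c ((stdSimplex.map _ t).1 1) = _
      rw [Subsingleton.elim t (stdSimplex.vertex 0), stdSimplex.map_vertex]
      simp
    · rw [← hc0]
      change c ((stdSimplex.map _ t).1 1) = _
      rw [Subsingleton.elim t (stdSimplex.vertex 0), stdSimplex.map_vertex]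
      simp

/-- If the coboundary of a `0`-cochain of `S^V` on `H` comes from the whole group, then the
cochain is equivariant for the whole group, provided that the Weyl action is trivial. -/
lemma bredonCochain_translate_of_coboundary_eq {M : MackeyFunctor G}
    (hM : ∀ K g x, M.weyl K g x = x) {H : Subgroup G}
    (e : bredonCochain (RepSphere W) (RepSphere.infty W) M 0 H)
    (f : bredonCochain (RepSphere W) (RepSphere.infty W) M 1 (⊤ : Subgroup G))
    (hef : bredonCoboundary _ _ M 0 H e = bredonCochainRes _ _ M le_top 1 f)
    (K : Set.Iic H) (g : G) (σ : FixedSimplex (RepSphere W) 0 K.1) :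
    e.1 K (σ.translate g) = M.weyl K.1 g (e.1 K σ) := by
  rw [hM]
  rcases RepSphere.translate_eq_or_exists_path W σ with h | ⟨τ, h0, h1⟩
  · rw [h]
  -- The coboundary on ρ is e(∂₀ρ) - e(∂₁ρ), and the second term vanishes at the base point. This
  -- applies to τ and to its translate by g, which also starts at ∞.
  · have hδ : ∀ ρ : FixedSimplex (RepSphere W) 1 K.1,
        (∀ t, (ρ.face 1).1 t = RepSphere.infty W) → e.1 K (ρ.face 0) = f.1 ⟨K.1, Set.mem_Iic.2 le_top⟩ ρ := by
      intro ρ hρ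
      have : ∑ a : Fin 2, (-1 : ℤ) ^ (a : ℕ) • e.1 K (ρ.face a) = f.1 ⟨K.1, Set.mem_Iic.2 le_top⟩ ρ :=
        congrFun (congrFun (congrArg Subtype.val hef) K) ρ
      rw [Fin.sum_univ_two, e.2.2.2 K _ hρ] at this
      simpa using this
    have h1' : ∀ t, ((τ.translate g).face 1).1 t = RepSphere.infty W := fun t =>
      (congrArg (g • ·) (h1 t)).trans (RepSphere.smul_infty W g)
    rw [← h0, hδ τ h1]
    refine (hδ (τ.translate g) h1').trans ?_
    rw [f.2.2.1 ⟨K.1, Set.mem_Iic.2 le_top⟩ g trivial τ, hM]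

end RepSphere

/-- Restriction in degrees `0` and `1` is injective for a Mackey functor with trivial Weyl action
whose restriction maps `M(G/K) → M(G/(K ⊓ H))` are isomorphisms. -/
theorem negSphereHomologyRes_injective {G : Type*} [CommGroup G] {V : Type*}
    [NormedAddCommGroup V] [NormedSpace ℝ V] [FiniteDimensional ℝ V] (W : Representation ℝ G V)
    {M : MackeyFunctor G} {H : Subgroup G} (hweyl : ∀ K g x, M.weyl K g x = x)
    (hM : ∀ K, Function.Bijective (M.res (inf_le_left : K ⊓ H ≤ K)))
    {ε : ℕ} (hε : ε = 0 ∨ ε = 1) :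
    Function.Injective (negSphereHomologyRes W M ε (le_top : H ≤ (⊤ : Subgroup G))) := by
  have hinj := bredonCochainRes_injective (X := RepSphere W) (x₀ := RepSphere.infty W)
    fun K => (hM K).1
  refine (injective_iff_map_eq_zero _).2 fun x hx => ?_
  obtain ⟨⟨f, hf⟩, rfl⟩ := QuotientAddGroup.mk_surjective x
  replace hx : bredonCochainRes _ _ M le_top ε f ∈ bredonBoundary _ _ M H ε :=
    (QuotientAddGroup.eq_zero_iff
      (bredonCocycleRes _ _ M le_top ε ⟨f, hf⟩)).1 hx
  refine (QuotientAddGroup.eq_zero_iff _).2 ?_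
  change f ∈ bredonBoundary _ _ M ⊤ ε
  rcases hε with rfl | rfl
  -- In degree 0 the boundary group is trivial, so the restricted cocycle itself is zero.
  · exact hinj 0 (Eq.trans hx (map_zero _).symm)
  · obtain ⟨e, he⟩ := hx
    obtain ⟨e', rfl⟩ := exists_bredonCochainRes_eq hM e
      (bredonCochain_translate_of_coboundary_eq W hweyl e f he)
    exact ⟨e', hinj 1 ((bredonCoboundary_res _ _ M le_top 0 e').symm.trans he)⟩

theorem mainTheorem7 (p k i j : ℕ) [Fact p.Prime] (hp : Odd p)
    (hj : 1 ≤ j) (hji : j < i) (hik : i ≤ k) (hijk : i + j ≤ k)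
    (G : Type*) [CommGroup G] [Finite G] [IsCyclic G] (hG : Nat.card G = p ^ k)
    (V : Type*) [NormedAddCommGroup V] [NormedSpace ℝ V] [FiniteDimensional ℝ V]
    (W : Representation ℝ G V)
    (C H : Subgroup G) (hC : Nat.card C = p ^ (i + j)) (hCH : C ≤ H)
    (ε : ℕ) (hε : ε = 0 ∨ ε = 1) :
    Function.Injective
      (negSphereHomologyRes W (mackeyB G p i j) ε (le_top : H ≤ (⊤ : Subgroup G))) :=
  negSphereHomologyRes_injective W (fun _ _ _ => rfl)
    (mackeyB_res_inf_bijective p k i j hG hC hCH) hε
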